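/- For $0<a\le 2$ let $f_a(x)=1-ax^2$, acting on $I=[-1,1]$. A periodic orbit of $f_a$ in $I$ of prime period $p$ is called unstable if $|(f_a^p)'|>1$ at its points, and super-stable if $(f_a^p)'=0$ at its points. An invariant probability measure $\mu$ on $I$ is called a natural measure of $f_a$ if $\frac1n\sum_{k=0}^{n-1}\delta_{f_a^k(x)}\to\mu$ in the weak* topology for all $x$ in a subset of $I$ of positive Lebesgue measure. Theorem D. Let $0<a\le 2$ and suppose that the critical orbit of $f_a$ is pre-periodic to an unstable periodic orbit $\{x_1,\dots,x_p\}$ of prime period $p$, i.e. $f_a^N(0)\in\{x_1,\dots,x_p\}$ for some $N\ge 0$. Then there are parameters $a_n\in(0,2]$, $n\ge 1$, with $a_n\ne a$ and $a_n\to a$, such that each $f_{a_n}$ has a super-stable periodic orbit $\{y_{n,1},\dots,y_{n,q_n}\}\subset I$ of prime period $q_n$, the measure $$\mu_{a_n}=\frac1{q_n}\sum_{j=1}^{q_n}\delta_{y_{n,j}}$$ is a natural measure of $f_{a_n}$, and $$\mu_{a_n}\xrightarrow{\ \text{weak}^*\ }\frac1p\sum_{i=1}^p\delta_{x_i}\qquad(n\to\infty).$$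 -/

import Mathlib

open Filter Topology MeasureTheory
open scoped NNReal

/-- The quadratic family `f_a(x) = 1 - a x²`. -/
def quadMap (a x : ℝ) : ℝ := 1 - a * x ^ 2

/-- `x` is a point of prime period `p` of `f_a` in the phase space `I = [-1, 1]`; its periodic
orbit consists of the `p` distinct points `f_a^i(x)`, `0 ≤ i < p`. -/
structure IsPeriodicOrbit (a x : ℝ) (p : ℕ) : Prop where
  mem : x ∈ Set.Icc (-1 : ℝ) 1
  period_pos : 0 < p
  minimalPeriod_eq : Function.minimalPeriod (quadMap a) x = p

/-- The set of points `{x, f_a(x), …, f_a^{p-1}(x)}`. -/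
def orbitSet (a x : ℝ) (p : ℕ) : Set ℝ := {z | ∃ i < p, (quadMap a)^[i] x = z}

/-- The multiplier `(f_a^p)'(x)`. -/
noncomputable def multiplier (a x : ℝ) (p : ℕ) : ℝ := deriv (quadMap a)^[p] x

/-- An unstable (hyperbolic repelling) periodic orbit. -/
def IsUnstableOrbit (a x : ℝ) (p : ℕ) : Prop :=
  IsPeriodicOrbit a x p ∧ 1 < |multiplier a x p|

/-- A super-stable periodic orbit (super-attractor). -/
def IsSuperStableOrbit (a x : ℝ) (p : ℕ) : Prop :=
  IsPeriodicOrbit a x p ∧ multiplier a x p = 0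

/-- The unit point mass at `x`. -/
noncomputable def pointMass (x : ℝ) : FiniteMeasure ℝ := ⟨Measure.dirac x, inferInstance⟩

/-- The measure `(1/n) ∑_{k<n} δ_{f_a^k(x)}` (a probability measure for `n ≥ 1`). When `x` has
prime period `n`, it is the uniform probability measure on the periodic orbit of `x`.
`FiniteMeasure ℝ` carries the topology of weak convergence. -/
noncomputable def orbitMeasure (a x : ℝ) (n : ℕ) : FiniteMeasure ℝ :=
  (n : ℝ≥0)⁻¹ • ∑ k ∈ Finset.range n, pointMass ((quadMap a)^[k] x)

/-- `x` is generic for `μ`: the empirical measures along the orbit of `x` converge to `μ`. -/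
def IsGeneric (a : ℝ) (μ : FiniteMeasure ℝ) (x : ℝ) : Prop :=
  Tendsto (fun n : ℕ => orbitMeasure a x n) atTop (𝓝 μ)

/-- `μ` is a natural measure for `f_a` on `I = [-1, 1]`: an invariant probability measure on `I`
for which a set of points of `I` of positive Lebesgue measure is generic. -/
structure IsNaturalMeasure (a : ℝ) (μ : FiniteMeasure ℝ) : Prop where
  isProbability : IsProbabilityMeasure (μ : Measure ℝ)
  supported : (μ : Measure ℝ) (Set.Icc (-1 : ℝ) 1)ᶜ = 0
  invariant : MeasurePreserving (quadMap a) (μ : Measure ℝ) (μ : Measure ℝ)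
  generic_pos : 0 < volume {x ∈ Set.Icc (-1 : ℝ) 1 | IsGeneric a μ x}

/-! An orbit that comes very close to a repelling periodic orbit needs a long time to leave its
neighbourhood, so it can spend most of its time there. The parameters are found to the left of `a`, at values `t`
where the critical orbit of `f_t` passes near the repelling orbit for a long time and then hits the
critical point after a bounded number `m` of further steps.

Let `P` be twice the period and let the critical orbit of `f_a` land on `x` at time `N`. The
polynomial `f_t^{N+P}(0) - f_t^N(0)` in `t` does not vanish identically, so for `t < a` near `a` the
critical orbit of `f_t` misses the repelling orbit, on a definite side; after moving `x` along its
orbit this is the right side (`LandsOnRepelling.exists_shift_eventually_lt`). Under `f_t^P` the point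
`f_t^N(0)` is then pushed away from `x` to the right, more and more slowly at the start as `t → a`.

On the right of `x` there are preimages of the critical point under `f_a`, arbitrarily close to `x`
(`LandsOnRepelling.exists_preimage`). This uses negative Schwarzian derivative, in the form of two
inequalities for chords of the iterates on intervals of monotonicity, each of which is multiplicative
under composition and trivial for a quadratic map: `iterSlope_self_mul_self_le` and
`iterSlope_mul_le_mul_iterSlope_self`. They show that a fixed point of `f_a^P` next to `x` would
attract the turning point of `f_a^P` that follows it, while all turning points land on the repelling
orbit. Such a preimage is a simple zero of `f_a^m`, so it persists for `t` near `a`, and by the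
intermediate value theorem in `t` the `k`-th return of the critical orbit can be made to hit it,
for all large `k` (`LandsOnRepelling.exists_periodic_critical`).

The number of returns outside a given neighbourhood of `x` is bounded independently of `k`
(`LandsOnRepelling.exists_criticalReturn_close`), so the averages along the periodic critical orbit
converge to those along the repelling orbit. A periodic critical orbit is super-stable, and its
measure is natural because it attracts a neighbourhood of `0`. -/

/-! ### Slopes of the iterates -/

/-- The slope `(f_a^n(u) - f_a^n(v)) / (u - v)` of the chord of `f_a^n` between `u` and `v`, written
as a product so that it also makes sense for `u = v`, where it is the derivative of `f_a^n`. -/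
def iterSlope (a : ℝ) (n : ℕ) (u v : ℝ) : ℝ :=
  ∏ j ∈ Finset.range n, -a * ((quadMap a)^[j] u + (quadMap a)^[j] v)

lemma iterSlope_zero (a u v : ℝ) : iterSlope a 0 u v = 1 := by simp [iterSlope]

lemma iterSlope_succ (a : ℝ) (n : ℕ) (u v : ℝ) :
    iterSlope a (n + 1) u v =
      iterSlope a n u v * (-a * ((quadMap a)^[n] u + (quadMap a)^[n] v)) := by
  simp [iterSlope, Finset.prod_range_succ]

lemma iterSlope_add (a : ℝ) (n m : ℕ) (u v : ℝ) :
    iterSlope a (n + m) u v =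
      iterSlope a n u v * iterSlope a m ((quadMap a)^[n] u) ((quadMap a)^[n] v) := by
  simp only [iterSlope, Finset.prod_range_add]
  congr 1
  refine Finset.prod_congr rfl fun j _ => ?_
  rw [add_comm n j, Function.iterate_add_apply, Function.iterate_add_apply]

lemma iterate_sub_iterate (a : ℝ) (n : ℕ) (u v : ℝ) :
    (quadMap a)^[n] u - (quadMap a)^[n] v = iterSlope a n u v * (u - v) := by
  induction n with
  | zero => simp [iterSlope_zero]
  | succ n ih =>
    rw [Function.iterate_succ_apply', Function.iterate_succ_apply', iterSlope_succ]
    have : quadMap a ((quadMap a)^[n] u) - quadMap a ((quadMap a)^[n] v) =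
        -a * ((quadMap a)^[n] u + (quadMap a)^[n] v) *
          ((quadMap a)^[n] u - (quadMap a)^[n] v) := by
      simp only [quadMap]; ring
    rw [this, ih]; ring

lemma continuous_iterate_uncurry (n : ℕ) :
    Continuous fun z : ℝ × ℝ => (quadMap z.1)^[n] z.2 := by
  induction n with
  | zero => exact continuous_snd
  | succ n ih =>
    simp only [Function.iterate_succ_apply']
    exact continuous_const.sub (continuous_fst.mul (ih.pow 2))

lemma continuous_iterate (a : ℝ) (n : ℕ) : Continuous (quadMap a)^[n] :=
  (continuous_iterate_uncurry n).comp (Continuous.prodMk_right a)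

lemma continuous_iterate_param (n : ℕ) (y : ℝ) : Continuous fun t => (quadMap t)^[n] y :=
  (continuous_iterate_uncurry n).comp (Continuous.prodMk_left y)

lemma continuous_iterSlope_uncurry (n : ℕ) :
    Continuous fun z : ℝ × ℝ × ℝ => iterSlope z.1 n z.2.1 z.2.2 := by
  refine continuous_finsetProd _ fun j _ => ?_
  refine continuous_fst.neg.mul (Continuous.add ?_ ?_)
  · exact (continuous_iterate_uncurry j).comp
      (continuous_fst.prodMk (continuous_fst.comp continuous_snd))
  · exact (continuous_iterate_uncurry j).comp
      (continuous_fst.prodMk (continuous_snd.comp continuous_snd))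

lemma hasDerivAt_iterate (a : ℝ) (n : ℕ) (u : ℝ) :
    HasDerivAt (quadMap a)^[n] (iterSlope a n u u) u := by
  rw [hasDerivAt_iff_tendsto_slope]
  have hc : Continuous fun v => iterSlope a n v u :=
    (continuous_iterSlope_uncurry n).comp (by fun_prop : Continuous fun v : ℝ => (a, v, u))
  refine (hc.continuousAt.tendsto.mono_left nhdsWithin_le_nhds).congr' ?_
  filter_upwards [self_mem_nhdsWithin] with v hv
  have hv' : v - u ≠ 0 := sub_ne_zero.2 hv
  rw [slope_def_field, iterate_sub_iterate]
  field_simp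

lemma iterate_mem_Icc {a : ℝ} (ha : a ∈ Set.Ioc (0 : ℝ) 2) {x : ℝ}
    (hx : x ∈ Set.Icc (-1 : ℝ) 1) (n : ℕ) : (quadMap a)^[n] x ∈ Set.Icc (-1 : ℝ) 1 := by
  have h : Set.MapsTo (quadMap a) (Set.Icc (-1 : ℝ) 1) (Set.Icc (-1 : ℝ) 1) := by
    intro y hy
    have h1 : y ^ 2 ≤ 1 := by nlinarith [hy.1, hy.2]
    constructor <;> simp only [quadMap] <;> nlinarith [ha.1, ha.2, sq_nonneg y]
  exact h.iterate n hx

lemma iterSlope_eq_one {a u v : ℝ} {n : ℕ} (hu : (quadMap a)^[n] u = u)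
    (hv : (quadMap a)^[n] v = v) (huv : u ≠ v) : iterSlope a n u v = 1 := by
  have h := iterate_sub_iterate a n u v
  rw [hu, hv] at h
  exact (mul_right_cancel₀ (sub_ne_zero.2 huv) (by rw [one_mul]; exact h)).symm

lemma iterSlope_self_ne_zero_iff {a : ℝ} (ha : a ≠ 0) {n : ℕ} {u : ℝ} :
    iterSlope a n u u ≠ 0 ↔ ∀ j < n, (quadMap a)^[j] u ≠ 0 := by
  simp only [iterSlope, Finset.prod_ne_zero_iff, Finset.mem_range, ← two_mul]
  simp [ha]

/-! ### Distortion of chords by the quadratic family -/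

lemma iterSlope_mul_iterSlope_nonneg {a u v u' v' : ℝ} {n : ℕ}
    (h : ∀ j < n, 0 ≤ ((quadMap a)^[j] u + (quadMap a)^[j] v) *
      ((quadMap a)^[j] u' + (quadMap a)^[j] v')) :
    0 ≤ iterSlope a n u v * iterSlope a n u' v' := by
  rw [iterSlope, iterSlope, ← Finset.prod_mul_distrib]
  refine Finset.prod_nonneg fun j hj => ?_
  nlinarith [mul_nonneg (sq_nonneg a) (h j (Finset.mem_range.1 hj))]

/-- An integrated form of negative Schwarzian derivative: the derivatives of `f_a^n` at the ends of
an interval of monotonicity have geometric mean at most the slope of the chord. Both sides are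
multiplicative in `n`, and for `n = 1` this is `4uv ≤ (u + v)²`. -/
lemma iterSlope_self_mul_self_le {a u v : ℝ} {n : ℕ}
    (h : ∀ j < n, 0 ≤ (quadMap a)^[j] u * (quadMap a)^[j] v) :
    iterSlope a n u u * iterSlope a n v v ≤ iterSlope a n u v ^ 2 := by
  simp only [iterSlope]
  rw [← Finset.prod_mul_distrib, ← Finset.prod_pow]
  refine Finset.prod_le_prod (fun j hj => ?_) (fun j hj => ?_)
  · nlinarith [mul_nonneg (sq_nonneg a) (h j (Finset.mem_range.1 hj))]
  · nlinarith [mul_nonneg (sq_nonneg a)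
      (sq_nonneg ((quadMap a)^[j] u - (quadMap a)^[j] v))]

/-- Expansion of an infinitesimal cross-ratio on an interval of monotonicity `[u, d]` of `f_a^n`.
Again both sides are multiplicative in `n`, and for `n = 1` this is `(w - u)(d - w) ≥ 0`. -/
lemma iterSlope_mul_le_mul_iterSlope_self {a u w d : ℝ} {n : ℕ} (huw : u ≤ w) (hwd : w ≤ d)
    (h₁ : ∀ j < n, 0 ≤ (quadMap a)^[j] u * (quadMap a)^[j] w)
    (h₂ : ∀ j < n, 0 ≤ (quadMap a)^[j] w * (quadMap a)^[j] d)
    (h₃ : ∀ j < n, 0 ≤ (quadMap a)^[j] u * (quadMap a)^[j] d) :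
    iterSlope a n u w * iterSlope a n w d ≤ iterSlope a n u d * iterSlope a n w w := by
  have key : ∀ j < n, 0 ≤ ((quadMap a)^[j] u + (quadMap a)^[j] w) *
      ((quadMap a)^[j] w + (quadMap a)^[j] d) := fun j hj => by
    nlinarith [h₁ j hj, h₂ j hj, h₃ j hj, sq_nonneg ((quadMap a)^[j] w)]
  simp only [iterSlope]
  rw [← Finset.prod_mul_distrib, ← Finset.prod_mul_distrib]
  refine Finset.prod_le_prod (fun j hj => ?_) (fun j hj => ?_)
  · nlinarith [mul_nonneg (sq_nonneg a) (key j (Finset.mem_range.1 hj))]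
  · -- monotonicity of `f_a^j` keeps `f_a^j w` between `f_a^j u` and `f_a^j d`
    have hb : 0 ≤ ((quadMap a)^[j] u - (quadMap a)^[j] w) *
        ((quadMap a)^[j] w - (quadMap a)^[j] d) := by
      rw [iterate_sub_iterate, iterate_sub_iterate]
      have := iterSlope_mul_iterSlope_nonneg (n := j)
        fun i hi => key i (hi.trans (Finset.mem_range.1 hj))
      have h2 : 0 ≤ (u - w) * (w - d) := by nlinarith
      nlinarith [mul_nonneg this h2]
    nlinarith [mul_nonneg (sq_nonneg a) hb]

/-! ### Preimages of the critical point next to the repelling orbit -/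

/-- After `N` steps the critical orbit of `f_a` lands on `x`, which `f_a^P` fixes with derivative
greater than `1`. Positivity of the derivative means that `P` may be twice the prime period. -/
structure LandsOnRepelling (a x : ℝ) (N P : ℕ) : Prop where
  param_mem : a ∈ Set.Ioc (0 : ℝ) 2
  mem : x ∈ Set.Icc (-1 : ℝ) 1
  iterate_eq : (quadMap a)^[P] x = x
  one_lt : 1 < iterSlope a P x x
  landing : (quadMap a)^[N] 0 = x

namespace LandsOnRepelling

variable {a x : ℝ} {N P : ℕ}

lemma period_pos (h : LandsOnRepelling a x N P) : 0 < P := by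
  rcases Nat.eq_zero_or_pos P with h0 | h0
  · have := h.one_lt
    simp [h0, iterSlope_zero] at this
  · exact h0

lemma iterate_iterate_eq (h : LandsOnRepelling a x N P) (i : ℕ) :
    (quadMap a)^[P] ((quadMap a)^[i] x) = (quadMap a)^[i] x := by
  rw [← Function.iterate_add_apply, add_comm, Function.iterate_add_apply, h.iterate_eq]

lemma iterate_mul_eq (h : LandsOnRepelling a x N P) (k : ℕ) : (quadMap a)^[P * k] x = x := by
  rw [Function.iterate_mul]
  exact Function.iterate_fixed h.iterate_eq k

lemma iterate_ne_zero (h : LandsOnRepelling a x N P) (j : ℕ) : (quadMap a)^[j] x ≠ 0 := by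
  have hne : ∀ j < P, (quadMap a)^[j] x ≠ 0 :=
    (iterSlope_self_ne_zero_iff h.param_mem.1.ne').1 (zero_lt_one.trans h.one_lt).ne'
  have hp : Function.IsPeriodicPt (quadMap a) P x := h.iterate_eq
  rw [← hp.iterate_mod_apply]
  exact hne _ (Nat.mod_lt _ h.period_pos)

lemma iterSlope_iterate (h : LandsOnRepelling a x N P) (i : ℕ) :
    iterSlope a P ((quadMap a)^[i] x) ((quadMap a)^[i] x) = iterSlope a P x x := by
  have h1 := iterSlope_add a i P x x
  have h2 := iterSlope_add a P i x x
  rw [h.iterate_eq, add_comm, h1, mul_comm] at h2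
  exact mul_right_cancel₀ ((iterSlope_self_ne_zero_iff h.param_mem.1.ne').2
    fun j _ => h.iterate_ne_zero j) h2

/-- The landing point may be moved along the repelling orbit. -/
lemma shift (h : LandsOnRepelling a x N P) (i : ℕ) :
    LandsOnRepelling a ((quadMap a)^[i] x) (N + i) P where
  param_mem := h.param_mem
  mem := iterate_mem_Icc h.param_mem h.mem i
  iterate_eq := h.iterate_iterate_eq i
  one_lt := by rw [h.iterSlope_iterate]; exact h.one_lt
  landing := by rw [add_comm, Function.iterate_add_apply, h.landing]

lemma lt_one (h : LandsOnRepelling a x N P) : x < 1 := by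
  refine lt_of_le_of_ne h.mem.2 fun hx1 => ?_
  obtain ⟨k, hk⟩ : ∃ k, P = k + 1 := ⟨P - 1, by have := h.period_pos; omega⟩
  have h1 := h.iterate_eq
  rw [hk, Function.iterate_succ_apply'] at h1
  -- `f_a(y) = 1` only for `y = 0`, so `x = 1` would put `0` on the repelling orbit
  have h2 : a * ((quadMap a)^[k] x) ^ 2 = 0 := by
    have h3 : 1 - a * ((quadMap a)^[k] x) ^ 2 = x := h1
    linarith
  exact h.iterate_ne_zero k (by simpa [h.param_mem.1.ne'] using h2)

/-- A point of which an iterate lies on the critical orbit eventually lies on the repelling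
orbit, at a multiple of `P` steps. -/
lemma exists_iterate_eq (h : LandsOnRepelling a x N P) {r : ℝ} {j m : ℕ}
    (hr : (quadMap a)^[j] r = (quadMap a)^[m] 0) :
    ∃ K i, (quadMap a)^[P * K] r = (quadMap a)^[i] x := by
  have hle : j + N ≤ P * (j + N) := Nat.le_mul_of_pos_left _ h.period_pos
  refine ⟨j + N, m + (P * (j + N) - (j + N)), ?_⟩
  have e1 : P * (j + N) = (P * (j + N) - (j + N)) + (N + j) := by omega
  rw [e1, Function.iterate_add_apply, Function.iterate_add_apply _ N j, hr,
    ← Function.iterate_add_apply _ N m, add_comm N m, Function.iterate_add_apply _ m N, h.landing,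
    ← Function.iterate_add_apply, ← e1]
  congr 1
  omega

/-- To the right of `x` there is a branch `[x, r]` of `f_a^P` whose right end `r` is a preimage of
the critical point and on which every point other than `x` is moved to the right. A fixed point
`w ∈ (x, r]` would be attracting by the two-point inequality, so there is no further fixed point in
`(w, r]` by the three-point inequality, and `r` would be attracted by `w`; but `r` lands on the
repelling orbit. -/
lemma exists_branch (h : LandsOnRepelling a x N P) :
    ∃ r, x < r ∧ (∃ j, (quadMap a)^[j] r = 0) ∧
      ∀ y ∈ Set.Ioc x r, y < (quadMap a)^[P] y := by
  set f := quadMap a with hf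
  have ha0 := h.param_mem.1
  have hcont : ∀ n, Continuous f^[n] := continuous_iterate a
  -- the first turning point of `f_a^P` to the right of `x`, or the end `1` of the phase space
  obtain ⟨r, hrZ, hrmin⟩ : ∃ r, IsLeast
      (Set.Icc x 1 ∩ ({1} ∪ ⋃ j ∈ Finset.range P, {y | f^[j] y = 0})) r := by
    refine IsCompact.exists_isLeast ?_ ⟨1, ⟨h.mem.2, le_rfl⟩, Or.inl rfl⟩
    refine isCompact_Icc.inter_right (isClosed_singleton.union ?_)
    exact isClosed_biUnion_finset fun j _ => isClosed_eq (hcont j) continuous_const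
  have hr1 : r ≤ 1 := hrZ.1.2
  have hxr : x < r := by
    refine lt_of_le_of_ne hrZ.1.1 fun hxr => ?_
    rcases hrZ.2 with h1 | h1
    · exact h.lt_one.ne (hxr.trans h1)
    · simp only [Set.mem_iUnion, Set.mem_ofPred_eq] at h1
      obtain ⟨j, -, hj⟩ := h1
      exact h.iterate_ne_zero j (hxr ▸ hj)
  have hnz : ∀ y ∈ Set.Ico x r, ∀ j < P, f^[j] y ≠ 0 := fun y hy j hj h0 => by
    refine hy.2.not_ge (hrmin ⟨⟨hy.1, hy.2.le.trans hr1⟩, Or.inr ?_⟩)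
    simp only [Set.mem_iUnion, Set.mem_ofPred_eq]
    exact ⟨j, Finset.mem_range.2 hj, h0⟩
  have hpos : ∀ y ∈ Set.Ico x r, ∀ j < P, 0 < f^[j] x * f^[j] y := fun y hy j hj => by
    by_contra! hc
    have hc0 : 0 < f^[j] x * f^[j] x := mul_self_pos.2 (hnz x ⟨le_rfl, hxr⟩ j hj)
    obtain ⟨z, hz, hz0⟩ := intermediate_value_Icc' hy.1
      (continuous_const.mul (hcont j) : Continuous fun z => f^[j] x * f^[j] z).continuousOn
      ⟨hc, hc0.le⟩
    have hz0 : f^[j] x * f^[j] z = 0 := hz0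
    rcases mul_eq_zero.1 hz0 with h0 | h0
    · exact hnz x ⟨le_rfl, hxr⟩ j hj h0
    · exact hnz z ⟨hz.1, hz.2.trans_lt hy.2⟩ j hj h0
  have hnn : ∀ y ∈ Set.Icc x r, ∀ j < P, 0 ≤ f^[j] x * f^[j] y := fun y hy j hj => by
    have : Set.Icc x r ⊆ {y | 0 ≤ f^[j] x * f^[j] y} := by
      rw [← closure_Ico hxr.ne]
      exact closure_minimal (fun y hy => (hpos y hy j hj).le)
        (isClosed_le continuous_const (continuous_const.mul (hcont j)))
    exact this hy
  have hsame : ∀ u ∈ Set.Icc x r, ∀ v ∈ Set.Icc x r, ∀ j < P, 0 ≤ f^[j] u * f^[j] v :=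
    fun u hu v hv j hj => by
      have h1 := hnn u hu j hj
      have h2 := hnn v hv j hj
      have h3 : 0 < f^[j] x * f^[j] x := hpos x ⟨le_rfl, hxr⟩ j hj
      by_contra! hc
      nlinarith [mul_nonneg h1 h2, mul_neg_of_pos_of_neg h3 hc]
  have hslope : ∀ u ∈ Set.Ico x r, ∀ v ∈ Set.Icc x r, 0 < iterSlope a P u v := by
    intro u hu v hv
    have hprod : 0 < iterSlope a P x x * iterSlope a P u v := by
      rw [iterSlope, iterSlope, ← Finset.prod_mul_distrib]
      refine Finset.prod_pos fun j hj => ?_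
      have h1 := hpos u hu j (Finset.mem_range.1 hj)
      have h2 := hnn v hv j (Finset.mem_range.1 hj)
      have h3 : 0 < a ^ 2 * (f^[j] x * f^[j] u + f^[j] x * f^[j] v) := by positivity
      nlinarith
    exact pos_of_mul_pos_right hprod (zero_lt_one.trans h.one_lt).le
  have hrland : ∃ K i, f^[P * K] r = f^[i] x := by
    rcases hrZ.2 with h1 | h1
    · exact h.exists_iterate_eq (j := 0) (m := 1) (by
        rw [Set.mem_singleton_iff.1 h1]; simp [quadMap])
    · simp only [Set.mem_iUnion, Set.mem_ofPred_eq] at h1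
      obtain ⟨j, -, hj⟩ := h1
      exact h.exists_iterate_eq (j := j) (m := 0) hj
  have hattr : ∀ w ∈ Set.Ioc x r, f^[P] w = w → iterSlope a P w w < 1 := fun w hw hfw => by
    have hle := iterSlope_self_mul_self_le (hsame x ⟨le_rfl, hxr.le⟩ w ⟨hw.1.le, hw.2⟩)
    rw [iterSlope_eq_one h.iterate_eq hfw hw.1.ne] at hle
    by_contra! hc
    nlinarith [h.one_lt]
  have hnotX : ∀ w ∈ Set.Ioc x r, ∀ i, w ≠ f^[i] x := fun w hw i hwi => by
    have h1 := hattr w hw (by rw [hwi]; exact h.iterate_iterate_eq i)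
    rw [hwi, h.iterSlope_iterate] at h1
    exact h1.not_gt h.one_lt
  have hnofix : ∀ w ∈ Set.Ioc x r, f^[P] w ≠ w := by
    intro w hw hfw
    have hwr : w < r := by
      refine lt_of_le_of_ne hw.2 fun hwr => ?_
      obtain ⟨K, i, hK⟩ := hrland
      rw [Function.iterate_mul, ← hwr, Function.iterate_fixed hfw] at hK
      exact hnotX w hw i hK
    have hnofix' : ∀ d ∈ Set.Ioc w r, f^[P] d ≠ d := fun d hd hfd => by
      have hx' : x ∈ Set.Icc x r := ⟨le_rfl, hxr.le⟩
      have hw' : w ∈ Set.Icc x r := ⟨hw.1.le, hw.2⟩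
      have hd' : d ∈ Set.Icc x r := ⟨(hw.1.trans hd.1).le, hd.2⟩
      have h3 := iterSlope_mul_le_mul_iterSlope_self hw.1.le hd.1.le (hsame x hx' w hw')
        (hsame w hw' d hd') (hsame x hx' d hd')
      rw [iterSlope_eq_one h.iterate_eq hfw hw.1.ne, iterSlope_eq_one hfw hfd hd.1.ne,
        iterSlope_eq_one h.iterate_eq hfd (hw.1.trans hd.1).ne] at h3
      linarith [hattr w hw hfw]
    have hdown : ∀ y ∈ Set.Ioc w r, f^[P] y < y := by
      have hev : ∀ᶠ y in 𝓝[>] w, f^[P] y < y := by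
        have hc : Continuous fun y => iterSlope a P y w :=
          (continuous_iterSlope_uncurry P).comp (by fun_prop : Continuous fun v : ℝ => (a, v, w))
        have : ∀ᶠ y in 𝓝[>] w, iterSlope a P y w < 1 :=
          nhdsWithin_le_nhds (hc.continuousAt.eventually (gt_mem_nhds (hattr w hw hfw)))
        filter_upwards [this, self_mem_nhdsWithin] with y hy hwy
        have h1 := iterate_sub_iterate a P y w
        rw [← hf, hfw] at h1
        have hwy' : 0 < y - w := sub_pos.2 hwy
        nlinarith
      obtain ⟨y₀, hy₀, hy₀mem⟩ := (hev.and (Ioc_mem_nhdsGT hwr)).exists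
      intro y hy
      by_contra! hc
      obtain ⟨z, hz, hz0⟩ := isPreconnected_Ioc.intermediate_value₂ hy₀mem hy
        (hcont P).continuousOn continuousOn_id hy₀.le hc
      exact hnofix' z hz hz0
    have hmem : ∀ k, f^[P * k] r ∈ Set.Ioc w r := by
      intro k
      induction k with
      | zero => simpa using hwr
      | succ k ih =>
        rw [Nat.mul_succ, add_comm, Function.iterate_add_apply]
        set y := f^[P * k] r
        refine ⟨?_, (hdown y ih).le.trans ih.2⟩
        have h1 := iterate_sub_iterate a P w y
        rw [← hf, hfw] at h1
        have h2 := hslope w ⟨hw.1.le, hwr⟩ y ⟨(hw.1.trans ih.1).le, ih.2⟩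
        nlinarith [ih.1]
    obtain ⟨K, i, hK⟩ := hrland
    exact hnotX _ (Set.Ioc_subset_Ioc_left hw.1.le (hmem K)) i hK
  have hup : ∀ y ∈ Set.Ioc x r, y < f^[P] y := by
    have hev : ∀ᶠ y in 𝓝[>] x, y < f^[P] y := by
      have hc : Continuous fun y => iterSlope a P y x :=
        (continuous_iterSlope_uncurry P).comp (by fun_prop : Continuous fun v : ℝ => (a, v, x))
      have : ∀ᶠ y in 𝓝[>] x, 1 < iterSlope a P y x :=
        nhdsWithin_le_nhds (hc.continuousAt.eventually (lt_mem_nhds h.one_lt))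
      filter_upwards [this, self_mem_nhdsWithin] with y hy hxy
      have h1 := iterate_sub_iterate a P y x
      rw [h.iterate_eq] at h1
      have hxy' : 0 < y - x := sub_pos.2 hxy
      nlinarith
    obtain ⟨y₀, hy₀, hy₀mem⟩ := (hev.and (Ioc_mem_nhdsGT hxr)).exists
    intro y hy
    by_contra! hc
    obtain ⟨z, hz, hz0⟩ := isPreconnected_Ioc.intermediate_value₂ hy hy₀mem
      (hcont P).continuousOn continuousOn_id hc hy₀.le
    exact hnofix z hz hz0
  refine ⟨r, hxr, ?_, hup⟩
  rcases hrZ.2 with h1 | h1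
  · have h2 := hup r ⟨hxr, le_rfl⟩
    rw [Set.mem_singleton_iff.1 h1] at h2
    exact absurd (iterate_mem_Icc h.param_mem ⟨by norm_num, le_rfl⟩ P).2 h2.not_ge
  · simp only [Set.mem_iUnion, Set.mem_ofPred_eq] at h1
    obtain ⟨j, -, hj⟩ := h1
    exact ⟨j, hj⟩

/-- Preimages of the critical point accumulate at `x` from the right. Taking the first hitting time
of the critical point makes the derivative nonzero. -/
lemma exists_preimage (h : LandsOnRepelling a x N P) {δ : ℝ} (hδ : 0 < δ) :
    ∃ v ∈ Set.Ioo x (x + δ), ∃ m, (quadMap a)^[m] v = 0 ∧ iterSlope a m v v ≠ 0 := by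
  obtain ⟨r, hxr, ⟨j, hj⟩, hup⟩ := h.exists_branch
  set f := quadMap a with hf
  obtain ⟨y, hxy, hyd⟩ := exists_between (lt_min hxr (lt_add_of_pos_right x hδ))
  have hyr : y ≤ r := (hyd.trans_le (min_le_left _ _)).le
  obtain ⟨K, hK⟩ : ∃ K, r < f^[P * K] y := by
    by_contra! hle
    have hmem : ∀ k, f^[P * k] y ∈ Set.Ioc x r := by
      intro k
      refine ⟨?_, hle k⟩
      induction k with
      | zero => simpa using hxy
      | succ k ih =>
        rw [Nat.mul_succ, add_comm, Function.iterate_add_apply]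
        exact ih.trans (hup _ ⟨ih, hle k⟩)
    have hmono : Monotone fun k => f^[P * k] y := by
      refine monotone_nat_of_le_succ fun k => ?_
      rw [Nat.mul_succ, add_comm, Function.iterate_add_apply]
      exact (hup _ (hmem k)).le
    have hlim := tendsto_atTop_ciSup hmono ⟨r, by rintro _ ⟨k, rfl⟩; exact hle k⟩
    set L := ⨆ k, f^[P * k] y
    have hfix : f^[P] L = L := by
      refine tendsto_nhds_unique (((continuous_iterate a P).tendsto L).comp hlim) ?_
      refine (hlim.comp (tendsto_add_atTop_nat 1)).congr fun k => ?_
      simp only [Function.comp_apply]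
      rw [Nat.mul_succ, add_comm, Function.iterate_add_apply]
    have hL : L ∈ Set.Ioc x r :=
      ⟨hxy.trans_le (hmono.ge_of_tendsto hlim 0), le_of_tendsto' hlim hle⟩
    exact (hup L hL).ne' hfix
  obtain ⟨v, hv, hvr⟩ := intermediate_value_Ioo hxy.le (continuous_iterate a (P * K)).continuousOn
    ⟨by rw [h.iterate_mul_eq]; exact hxr, hK⟩
  have hex : ∃ m, f^[m] v = 0 := ⟨j + P * K, by rw [Function.iterate_add_apply, hvr, hj]⟩
  classical
  exact ⟨v, ⟨hv.1, hv.2.trans (hyd.trans_le (min_le_right _ _))⟩, Nat.find hex, Nat.find_spec hex,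
    (iterSlope_self_ne_zero_iff h.param_mem.1.ne').2 fun j hj => Nat.find_min hex hj⟩

end LandsOnRepelling

/-! ### The side on which the perturbed critical orbit leaves -/

/-- The polynomial `t ↦ f_t^n(0)`. -/
noncomputable def criticalPoly : ℕ → Polynomial ℝ
  | 0 => 0
  | n + 1 => 1 - Polynomial.X * criticalPoly n ^ 2

lemma eval_criticalPoly (t : ℝ) (n : ℕ) : (criticalPoly n).eval t = (quadMap t)^[n] 0 := by
  induction n with
  | zero => simp [criticalPoly]
  | succ n ih => simp [criticalPoly, ih, Function.iterate_succ_apply', quadMap]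

/-- A critical orbit relation `f_t^m(0) = f_t^n(0)` holds only for isolated parameters `t`. -/
lemma eventually_iterate_ne (a : ℝ) {m n : ℕ} (hmn : m < n) :
    ∀ᶠ t in 𝓝[≠] a, (quadMap t)^[m] 0 ≠ (quadMap t)^[n] 0 := by
  have hne : criticalPoly n - criticalPoly m ≠ 0 := by
    intro h0
    -- for `t = -1` the critical orbit `0, 1, 2, 5, …` increases
    have hmono : StrictMono fun k => (quadMap (-1))^[k] 0 := by
      refine strictMono_nat_of_lt_succ fun k => ?_
      rw [Function.iterate_succ_apply']
      simp only [quadMap]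
      nlinarith [sq_nonneg ((quadMap (-1))^[k] 0 - 1)]
    have h1 := congrArg (Polynomial.eval (-1)) h0
    rw [Polynomial.eval_sub, eval_criticalPoly, eval_criticalPoly, Polynomial.eval_zero] at h1
    exact (hmono hmn).ne' (sub_eq_zero.1 h1)
  have hfin : ({t | (criticalPoly n - criticalPoly m).IsRoot t} \ {a}).Finite :=
    (Polynomial.finite_setOfPred_isRoot hne).sdiff
  filter_upwards [nhdsWithin_le_nhds (hfin.isClosed.isOpen_compl.mem_nhds fun ha => ha.2 rfl),
    self_mem_nhdsWithin] with t ht hta heq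
  refine ht ⟨?_, hta⟩
  change (criticalPoly n - criticalPoly m).eval t = 0
  rw [Polynomial.eval_sub, eval_criticalPoly, eval_criticalPoly, heq, sub_self]

lemma eventually_gt_or_lt (a : ℝ) {m n : ℕ} (hmn : m < n) :
    (∀ᶠ t in 𝓝[<] a, (quadMap t)^[m] 0 < (quadMap t)^[n] 0) ∨
      ∀ᶠ t in 𝓝[<] a, (quadMap t)^[n] 0 < (quadMap t)^[m] 0 := by
  have hne : ∀ᶠ t in 𝓝[<] a, (quadMap t)^[m] 0 ≠ (quadMap t)^[n] 0 :=
    nhdsWithin_mono _ (fun t ht => ne_of_lt ht) (eventually_iterate_ne a hmn)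
  obtain ⟨c, hc, hcn⟩ := (mem_nhdsLT_iff_exists_Ioo_subset).1 hne
  have hmem := Ioo_mem_nhdsLT (Set.mem_Iio.1 hc)
  by_cases hex : ∃ t₀ ∈ Set.Ioo c a, (quadMap t₀)^[m] 0 < (quadMap t₀)^[n] 0
  · left
    obtain ⟨t₀, ht₀, hlt⟩ := hex
    filter_upwards [hmem] with t ht
    by_contra! hle
    obtain ⟨s, hs, hs0⟩ := isPreconnected_Ioo.intermediate_value₂ ht₀ ht
      (continuous_iterate_param m 0).continuousOn (continuous_iterate_param n 0).continuousOn
      hlt.le hle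
    exact hcn hs hs0
  · right
    push Not at hex
    filter_upwards [hmem] with t ht
    exact lt_of_le_of_ne (hex t ht) (hcn ht).symm

namespace LandsOnRepelling

variable {a x : ℝ} {N P : ℕ}

/-- The landing point can be chosen such that, for `t < a` near `a`, the critical orbit of `f_t`
leaves it to the right. If it leaves to the left of a positive point, then it leaves to the right of
the image of that point, where `f_t` reverses orientation. If there is no positive point, the claim
holds because `f_t(y) > y` on `[-1, 0]` for `t < 2`. -/
lemma exists_shift_eventually_lt (h : LandsOnRepelling a x N P) :
    ∃ i, ∀ᶠ t in 𝓝[<] a, (quadMap t)^[N + i] 0 < (quadMap t)^[N + i + P] 0 := by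
  have hP := h.period_pos
  have hland : ∀ i, (quadMap a)^[N + i] 0 = (quadMap a)^[i] x := fun i => (h.shift i).landing
  have hlim : ∀ n, Tendsto (fun t => (quadMap t)^[n] 0) (𝓝[<] a) (𝓝 ((quadMap a)^[n] 0)) :=
    fun n => ((continuous_iterate_param n 0).tendsto a).mono_left nhdsWithin_le_nhds
  have ht : ∀ᶠ t in 𝓝[<] a, t ∈ Set.Ioo 0 a := Ioo_mem_nhdsLT h.param_mem.1
  by_cases hpos : ∃ i, 0 < (quadMap a)^[i] x
  · obtain ⟨i, hi⟩ := hpos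
    rcases eventually_gt_or_lt a (show N + i < N + i + P by omega) with hr | hl
    · exact ⟨i, hr⟩
    · refine ⟨i + 1, ?_⟩
      have h1 : ∀ᶠ t in 𝓝[<] a, 0 < (quadMap t)^[N + i] 0 :=
        (hlim (N + i)).eventually (lt_mem_nhds (by rw [hland]; exact hi))
      have h2 : ∀ᶠ t in 𝓝[<] a, 0 < (quadMap t)^[N + i + P] 0 :=
        (hlim (N + i + P)).eventually (lt_mem_nhds (by
          rw [add_comm, Function.iterate_add_apply, hland, h.iterate_iterate_eq]; exact hi))
      filter_upwards [hl, h1, h2, ht] with t hl h1 h2 ht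
      rw [show N + (i + 1) + P = N + i + P + 1 by omega, ← add_assoc,
        Function.iterate_succ_apply', Function.iterate_succ_apply']
      change 1 - t * _ ^ 2 < 1 - t * _ ^ 2
      have : ((quadMap t)^[N + i + P] 0) ^ 2 < ((quadMap t)^[N + i] 0) ^ 2 := by gcongr
      have := mul_lt_mul_of_pos_left this ht.1
      linarith
  · push Not at hpos
    refine ⟨0, ?_⟩
    have hneg : ∀ j, ∀ᶠ t in 𝓝[<] a, (quadMap t)^[N + j] 0 < 0 := fun j =>
      (hlim (N + j)).eventually (gt_mem_nhds (by
        rw [hland]; exact lt_of_le_of_ne (hpos j) (h.iterate_ne_zero j)))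
    filter_upwards [(Filter.eventually_all_finset (Finset.range P)).2 fun j _ => hneg j, ht]
      with t hneg ht
    have hstep : ∀ j < P, (quadMap t)^[N + j] 0 < (quadMap t)^[N + (j + 1)] 0 := fun j hj => by
      have hy0 := hneg j (Finset.mem_range.2 hj)
      have hy1 := (iterate_mem_Icc ⟨ht.1, ht.2.le.trans h.param_mem.2⟩
        (show (0 : ℝ) ∈ Set.Icc (-1 : ℝ) 1 by norm_num) (N + j)).1
      rw [← add_assoc, Function.iterate_succ_apply']
      set y := (quadMap t)^[N + j] 0
      have ht2 : t < 2 := ht.2.trans_le h.param_mem.2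
      have hy2 : 0 < y ^ 2 := sq_pos_of_neg hy0
      simp only [quadMap]
      nlinarith [mul_lt_mul_of_pos_right ht2 hy2]
    have hle : ∀ j ≤ P, 0 < j → (quadMap t)^[N] 0 < (quadMap t)^[N + j] 0 := by
      intro j
      induction j with
      | zero => intro _ h0; exact absurd h0 (lt_irrefl _)
      | succ j ih =>
        intro hj _
        rcases Nat.eq_zero_or_pos j with h0 | h0
        · subst h0; exact hstep 0 hj
        · exact (ih (by omega) h0).trans (hstep j hj)
    exact hle P le_rfl hP

end LandsOnRepelling

/-! ### Parameters with a periodic critical point -/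

/-- A sequence that starts above `l` and increases by `d > 0` in its first step, and whose
increments do not shrink as long as it stays in `[l, u]`, increases by at least `d` in each step
until it exceeds `u`. -/
lemma le_increment_of_expanding {w : ℕ → ℝ} {l u d : ℝ} (hl : l ≤ w 0) (hd : 0 < d)
    (h0 : d ≤ w 1 - w 0)
    (hstep : ∀ j, w j ∈ Set.Icc l u → w (j + 1) ∈ Set.Icc l u → w j ≤ w (j + 1) →
      w (j + 1) - w j ≤ w (j + 2) - w (j + 1)) {k : ℕ} (hk : ∀ j < k, w j ≤ u) :
    ∀ j < k, l ≤ w j ∧ d ≤ w (j + 1) - w j := by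
  intro j
  induction j with
  | zero => exact fun _ => ⟨hl, h0⟩
  | succ j ih =>
    intro hj
    obtain ⟨h1, h2⟩ := ih (by omega)
    have h3 : l ≤ w (j + 1) := by linarith
    exact ⟨h3, h2.trans (hstep j ⟨h1, hk j (by omega)⟩ ⟨h3, hk _ hj⟩ (by linarith))⟩

/-- The points of the critical orbit of `f_t` at the times `N + Pk`. -/
def criticalReturn (N P : ℕ) (t : ℝ) (k : ℕ) : ℝ := (quadMap t)^[N + P * k] 0

lemma criticalReturn_zero (N P : ℕ) (t : ℝ) : criticalReturn N P t 0 = (quadMap t)^[N] 0 := by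
  simp [criticalReturn]

lemma criticalReturn_succ (N P : ℕ) (t : ℝ) (k : ℕ) :
    criticalReturn N P t (k + 1) = (quadMap t)^[P] (criticalReturn N P t k) := by
  rw [criticalReturn, criticalReturn, ← Function.iterate_add_apply]
  congr 1
  ring

lemma continuous_criticalReturn (N P k : ℕ) : Continuous fun t => criticalReturn N P t k :=
  continuous_iterate_param _ _

/-- `f_t^P` expands all chords in the `δ`-neighbourhood of `x` by the factor `κ`. -/
def ExpandsNear (t x δ κ : ℝ) (P : ℕ) : Prop :=
  ∀ u ∈ Set.Icc (x - δ) (x + δ), ∀ v ∈ Set.Icc (x - δ) (x + δ), κ ≤ iterSlope t P u v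

lemma ExpandsNear.le_increment {t x δ κ : ℝ} {N P : ℕ} (he : ExpandsNear t x δ κ P) (hκ : 1 ≤ κ)
    (h0 : x - δ ≤ (quadMap t)^[N] 0) (hr : (quadMap t)^[N] 0 < (quadMap t)^[N + P] 0) {k : ℕ}
    (hk : ∀ j < k, criticalReturn N P t j ≤ x + δ) :
    ∀ j < k, x - δ ≤ criticalReturn N P t j ∧ (quadMap t)^[N + P] 0 - (quadMap t)^[N] 0 ≤
      criticalReturn N P t (j + 1) - criticalReturn N P t j := by
  refine le_increment_of_expanding (by rwa [criticalReturn_zero]) (sub_pos.2 hr) ?_ ?_ hk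
  · simp [criticalReturn]
  · intro j h1 h2 h3
    have hsub := iterate_sub_iterate t P (criticalReturn N P t (j + 1)) (criticalReturn N P t j)
    rw [← criticalReturn_succ, ← criticalReturn_succ, add_assoc] at hsub
    rw [hsub]
    exact le_mul_of_one_le_left (sub_nonneg.2 h3) (hκ.trans (he _ h2 _ h1))

namespace LandsOnRepelling

variable {a x : ℝ} {N P : ℕ}

lemma criticalReturn_eq (h : LandsOnRepelling a x N P) (k : ℕ) : criticalReturn N P a k = x := by
  rw [criticalReturn, add_comm, Function.iterate_add_apply, h.landing, h.iterate_mul_eq]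

lemma exists_expandsNear (h : LandsOnRepelling a x N P) :
    ∃ δ > 0, ∃ κ > 1, ∀ᶠ t in 𝓝[<] a, ExpandsNear t x δ κ P := by
  obtain ⟨κ, hκ, hκS⟩ := exists_between h.one_lt
  obtain ⟨r, hr, hball⟩ := Metric.eventually_nhds_iff.1
    (((continuous_iterSlope_uncurry P).tendsto (a, x, x)).eventually (lt_mem_nhds hκS))
  refine ⟨r / 2, half_pos hr, κ, hκ, nhdsWithin_le_nhds ?_⟩
  filter_upwards [Metric.ball_mem_nhds a hr] with t ht u hu v hv
  refine (hball (y := (t, u, v)) ?_).le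
  rw [Prod.dist_eq, Prod.dist_eq, max_lt_iff, max_lt_iff]
  refine ⟨ht, ?_, ?_⟩ <;> rw [Real.dist_eq, abs_lt] <;> constructor <;> linarith [hu.1, hu.2, hv.1, hv.2]

/-- Close to `a` there are parameters for which the critical point is periodic, where the critical
orbit makes any large number `k` of returns near `x` and needs only a fixed number `m` of further
steps. -/
lemma exists_periodic_critical (h : LandsOnRepelling a x N P)
    (hright : ∀ᶠ t in 𝓝[<] a, (quadMap t)^[N] 0 < (quadMap t)^[N + P] 0) {δ κ : ℝ} (hδ : 0 < δ)
    (hκ : 1 < κ) (he : ∀ᶠ t in 𝓝[<] a, ExpandsNear t x δ κ P) :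
    ∃ m, ∀ c < a, ∀ᶠ k in atTop, ∃ t ∈ Set.Ioo c a,
      (quadMap t)^[N + P * k + m] 0 = 0 ∧ ∀ j ≤ k, criticalReturn N P t j ≤ x + δ := by
  obtain ⟨v, hv, m, hvm, hvS⟩ := h.exists_preimage hδ
  refine ⟨m, fun c hc => ?_⟩
  -- `f_a^m` changes sign at its simple zero `v`
  obtain ⟨v₁, v₂, hxv₁, hv₁₂, hv₂, hsign⟩ : ∃ v₁ v₂, x < v₁ ∧ v₁ < v₂ ∧ v₂ < x + δ ∧
      (quadMap a)^[m] v₁ * (quadMap a)^[m] v₂ < 0 := by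
    have hc : Continuous fun s : ℝ => iterSlope a m (v - s) v * iterSlope a m (v + s) v :=
      ((continuous_iterSlope_uncurry m).comp
        (by fun_prop : Continuous fun s : ℝ => (a, v - s, v))).mul
      ((continuous_iterSlope_uncurry m).comp (by fun_prop : Continuous fun s : ℝ => (a, v + s, v)))
    have hev : ∀ᶠ s in 𝓝[>] (0 : ℝ), 0 < iterSlope a m (v - s) v * iterSlope a m (v + s) v := by
      refine nhdsWithin_le_nhds ((hc.tendsto 0).eventually (lt_mem_nhds ?_))
      simpa using hvS
    have hsmall : ∀ᶠ s in 𝓝[>] (0 : ℝ), s ∈ Set.Ioo 0 (min (v - x) (x + δ - v)) :=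
      Ioo_mem_nhdsGT (lt_min (by linarith [hv.1]) (by linarith [hv.2]))
    obtain ⟨s, hs, hs0, hsm⟩ := (hev.and hsmall).exists
    refine ⟨v - s, v + s, by linarith [min_le_left (v - x) (x + δ - v)], by linarith,
      by linarith [min_le_right (v - x) (x + δ - v)], ?_⟩
    have h1 := iterate_sub_iterate a m (v - s) v
    have h2 := iterate_sub_iterate a m (v + s) v
    rw [hvm, sub_zero] at h1 h2
    rw [h1, h2]
    nlinarith [mul_pos hs (mul_pos hs0 hs0)]
  have hA1 : (quadMap a)^[m] v₁ ≠ 0 := left_ne_zero_of_mul hsign.ne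
  have hA2 : (quadMap a)^[m] v₂ ≠ 0 := right_ne_zero_of_mul hsign.ne
  have hs : ∀ u, (quadMap a)^[m] u ≠ 0 →
      ∀ᶠ t in 𝓝[<] a, 0 < (quadMap a)^[m] u * (quadMap t)^[m] u := fun u hu =>
    nhdsWithin_le_nhds (((continuous_const.mul (continuous_iterate_param m u)).tendsto a).eventually
      (lt_mem_nhds (mul_self_pos.2 hu)))
  have hstart : ∀ᶠ t in 𝓝[<] a, x - δ ≤ (quadMap t)^[N] 0 :=
    nhdsWithin_le_nhds (((continuous_iterate_param N 0).tendsto a).eventually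
      ((lt_mem_nhds (by rw [h.landing]; linarith)).mono fun _ => le_of_lt))
  obtain ⟨c₀, hc₀, hall⟩ := mem_nhdsLT_iff_exists_Ioo_subset.1
    (hright.and (he.and (hstart.and ((hs v₁ hA1).and (hs v₂ hA2)))))
  obtain ⟨t₀, ht₀, ht₀a⟩ := exists_between (max_lt hc (Set.mem_Iio.1 hc₀))
  have hmem : ∀ t, t₀ ≤ t → t < a → t ∈ Set.Ioo c₀ a := fun t h1 h2 =>
    ⟨((le_max_right _ _).trans_lt ht₀).trans_le h1, h2⟩
  obtain ⟨K, hK⟩ : ∃ K, v₂ ≤ criticalReturn N P t₀ K := by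
    by_contra! hlt
    obtain ⟨h1, h2, h3, -⟩ := hall (hmem t₀ le_rfl ht₀a)
    set d := (quadMap t₀)^[N + P] 0 - (quadMap t₀)^[N] 0
    have hd : 0 < d := sub_pos.2 h1
    have hinc : ∀ k, d ≤ criticalReturn N P t₀ (k + 1) - criticalReturn N P t₀ k := fun k =>
      (h2.le_increment hκ.le h3 h1 (k := k + 1) (fun j _ => (hlt j).le.trans hv₂.le) k
        k.lt_succ_self).2
    have hlin : ∀ k : ℕ, x - δ + k * d ≤ criticalReturn N P t₀ k := by
      intro k
      induction k with
      | zero => simpa [criticalReturn_zero] using h3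
      | succ k ih => push_cast; linarith [hinc k]
    obtain ⟨k, hk⟩ := exists_nat_gt ((v₂ - (x - δ)) / d)
    rw [div_lt_iff₀ hd] at hk
    linarith [hlin k, hlt k]
  filter_upwards [eventually_ge_atTop K] with k hk
  -- the last parameter for which the first `k` returns reach `v₂`
  obtain ⟨s, hsE, hsmax⟩ : ∃ s, IsGreatest
      (Set.Icc t₀ a ∩ ⋃ j ∈ Finset.range (k + 1), {t | v₂ ≤ criticalReturn N P t j}) s := by
    refine IsCompact.exists_isGreatest ?_ ⟨t₀, ⟨le_rfl, ht₀a.le⟩, ?_⟩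
    · exact isCompact_Icc.inter_right (isClosed_biUnion_finset fun j _ =>
        isClosed_le continuous_const (continuous_criticalReturn N P j))
    · simp only [Set.mem_iUnion, Set.mem_ofPred_eq]
      exact ⟨K, Finset.mem_range.2 (by omega), hK⟩
  obtain ⟨⟨hs₀, hsa'⟩, hsE⟩ := hsE
  simp only [Set.mem_iUnion, Set.mem_ofPred_eq, Finset.mem_range] at hsE
  obtain ⟨j₀, hj₀, hsj₀⟩ := hsE
  have hsa : s < a := by
    refine lt_of_le_of_ne hsa' fun hsa => ?_
    rw [hsa, h.criticalReturn_eq] at hsj₀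
    linarith
  have hlt : ∀ t, s < t → t ≤ a → ∀ j ≤ k, criticalReturn N P t j < v₂ := fun t h1 h2 j hj => by
    by_contra! hle
    refine h1.not_ge (hsmax ⟨⟨hs₀.trans h1.le, h2⟩, ?_⟩)
    simp only [Set.mem_iUnion, Set.mem_ofPred_eq]
    exact ⟨j, Finset.mem_range.2 (by omega), hle⟩
  have hle : ∀ t, s ≤ t → t ≤ a → ∀ j ≤ k, criticalReturn N P t j ≤ v₂ := fun t h1 h2 j hj => by
    rcases h1.eq_or_lt with rfl | h1
    · refine le_of_tendsto (((continuous_criticalReturn N P j).tendsto s).mono_left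
        (nhdsWithin_le_nhds (s := Set.Ioi s))) ?_
      filter_upwards [Ioo_mem_nhdsGT hsa] with t ht
      exact (hlt t ht.1 ht.2.le j hj).le
    · exact (hlt t h1 h2 j hj).le
  have hsk : criticalReturn N P s k = v₂ := by
    obtain ⟨h1, h2, h3, -⟩ := hall (hmem s hs₀ hsa)
    have hinc := h2.le_increment hκ.le h3 h1 (k := k)
      fun j hj => (hle s le_rfl hsa.le j hj.le).trans hv₂.le
    have hmono : ∀ i, j₀ + i ≤ k → criticalReturn N P s j₀ ≤ criticalReturn N P s (j₀ + i) := by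
      intro i
      induction i with
      | zero => exact fun _ => le_rfl
      | succ i ih =>
        intro hi
        have := (hinc (j₀ + i) (by omega)).2
        rw [← add_assoc]
        linarith [ih (by omega)]
    refine le_antisymm (hle s le_rfl hsa.le k le_rfl) (hsj₀.trans ?_)
    have := hmono (k - j₀) (by omega)
    rwa [Nat.add_sub_cancel' (by omega)] at this
  obtain ⟨t₁, ht₁, ht₁v⟩ := intermediate_value_Icc' hsa.le
    (continuous_criticalReturn N P k).continuousOn
    (show v₁ ∈ Set.Icc (criticalReturn N P a k) (criticalReturn N P s k) by
      rw [hsk, h.criticalReturn_eq]; exact ⟨hxv₁.le, hv₁₂.le⟩)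
  have ht₁v : criticalReturn N P t₁ k = v₁ := ht₁v
  have ht₁a : t₁ < a := by
    refine lt_of_le_of_ne ht₁.2 fun h1 => ?_
    rw [h1, h.criticalReturn_eq] at ht₁v
    exact hxv₁.ne ht₁v
  have hφ : Continuous fun t => (quadMap a)^[m] v₁ * (quadMap t)^[m] (criticalReturn N P t k) :=
    continuous_const.mul ((continuous_iterate_uncurry m).comp
      (continuous_id.prodMk (continuous_criticalReturn N P k)))
  obtain ⟨t, ht, ht0⟩ := intermediate_value_Icc ht₁.1 hφ.continuousOn
    (show (0 : ℝ) ∈ Set.Icc _ _ from ⟨by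
      rw [hsk]
      have h1 := (hall (hmem s hs₀ hsa)).2.2.2.2
      by_contra! h2
      nlinarith [mul_pos h1 h2, mul_neg_of_neg_of_pos hsign (mul_self_pos.2
        (right_ne_zero_of_mul h1.ne'))], by
      rw [ht₁v]
      exact (hall (hmem t₁ (hs₀.trans ht₁.1) ht₁a)).2.2.2.1.le⟩)
  have ht0 : (quadMap a)^[m] v₁ * (quadMap t)^[m] (criticalReturn N P t k) = 0 := ht0
  have hta : t < a := ht.2.trans_lt ht₁a
  refine ⟨t, ⟨((le_max_left _ _).trans_lt ht₀).trans_le (hs₀.trans ht.1), hta⟩, ?_,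
    fun j hj => (hle t ht.1 hta.le j hj).trans hv₂.le⟩
  rw [add_comm, Function.iterate_add_apply]
  exact (mul_eq_zero.1 ht0).resolve_left hA1

/-- Among the `k` returns that stay in the expanding neighbourhood, all but the last boundedly many
are `ε`-close to `x`, uniformly in the parameter. -/
lemma exists_criticalReturn_close (h : LandsOnRepelling a x N P)
    (hright : ∀ᶠ t in 𝓝[<] a, (quadMap t)^[N] 0 < (quadMap t)^[N + P] 0) {δ κ : ℝ} (hδ : 0 < δ)
    (hκ : 1 < κ) (he : ∀ᶠ t in 𝓝[<] a, ExpandsNear t x δ κ P) {ε : ℝ} (hε : 0 < ε) :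
    ∃ C : ℕ, ∀ᶠ t in 𝓝[<] a, ∀ k, (∀ j ≤ k, criticalReturn N P t j ≤ x + δ) →
      ∀ j, j + C ≤ k → |criticalReturn N P t j - x| < ε := by
  set c := (κ - 1) * ε / 2 with hcdef
  have hc : 0 < c := by have := sub_pos.2 hκ; positivity
  obtain ⟨C, hC⟩ := exists_nat_gt (δ / c)
  rw [div_lt_iff₀ hc] at hC
  refine ⟨C, ?_⟩
  have hcN := (continuous_iterate_param N 0).tendsto a
  have hstart : ∀ᶠ t in 𝓝[<] a, x - δ ≤ (quadMap t)^[N] 0 :=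
    nhdsWithin_le_nhds (hcN.eventually
      ((lt_mem_nhds (by rw [h.landing]; linarith)).mono fun _ => le_of_lt))
  have hstart' : ∀ᶠ t in 𝓝[<] a, x - ε < (quadMap t)^[N] 0 :=
    nhdsWithin_le_nhds (hcN.eventually (lt_mem_nhds (by rw [h.landing]; linarith)))
  have hfix : ∀ᶠ t in 𝓝[<] a, x - c < (quadMap t)^[P] x :=
    nhdsWithin_le_nhds (((continuous_iterate_param P x).tendsto a).eventually
      (lt_mem_nhds (by rw [h.iterate_eq]; linarith)))
  filter_upwards [hright, he, hstart, hstart', hfix] with t h1 h2 h3 h4 h5 k hk j hj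
  have hinc := h2.le_increment hκ.le h3 h1 (k := k) fun j hj => hk j hj.le
  have hmono : ∀ i, j ≤ i → i ≤ k → criticalReturn N P t j ≤ criticalReturn N P t i := by
    intro i hji
    induction i, hji using Nat.le_induction with
    | base => exact fun _ => le_rfl
    | succ i hi ih => intro hik; linarith [(hinc i hik).2, ih (by omega)]
  have hlow : ∀ i ≤ k, x - ε < criticalReturn N P t i := by
    intro i
    induction i with
    | zero => intro _; rwa [criticalReturn_zero]
    | succ i ih => intro hi; linarith [(hinc i hi).2, ih (by omega)]
  rw [abs_lt]
  refine ⟨by linarith [hlow j (by omega)], ?_⟩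
  -- beyond `x + ε` each return moves by at least `c`, so at most `δ / c` of them fit below `x + δ`
  by_contra! hge
  have hlin : ∀ i : ℕ, j + i ≤ k → x + ε + i * c ≤ criticalReturn N P t (j + i) := by
    intro i
    induction i with
    | zero => intro _; simp only [Nat.cast_zero, add_zero]; linarith
    | succ i ih =>
      intro hi
      have hy := hmono (j + i) (by omega) (by omega)
      have hyu := hk (j + i) (by omega)
      have hS := h2 (criticalReturn N P t (j + i)) ⟨(hinc (j + i) (by omega)).1, hyu⟩ x
        ⟨by linarith, by linarith⟩
      have hsub := iterate_sub_iterate t P (criticalReturn N P t (j + i)) x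
      rw [← criticalReturn_succ] at hsub
      have hprod : κ * (criticalReturn N P t (j + i) - x) ≤
          iterSlope t P (criticalReturn N P t (j + i)) x * (criticalReturn N P t (j + i) - x) :=
        mul_le_mul_of_nonneg_right hS (by linarith)
      have hgain : (κ - 1) * ε ≤ (κ - 1) * (criticalReturn N P t (j + i) - x) :=
        mul_le_mul_of_nonneg_left (by linarith) (by linarith)
      rw [← add_assoc]
      push_cast
      linarith [ih (by omega)]
  linarith [hlin C hj, hk (j + C) hj]

end LandsOnRepelling

/-! ### Averages along orbits -/

lemma sum_range_mul_eq (f : ℕ → ℝ) (P k : ℕ) :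
    ∑ j ∈ Finset.range (P * k), f j =
      ∑ j ∈ Finset.range k, ∑ i ∈ Finset.range P, f (P * j + i) := by
  induction k with
  | zero => simp
  | succ k ih => rw [Nat.mul_succ, Finset.sum_range_add, ih, Finset.sum_range_succ]

lemma average_mul_of_periodic {f : ℕ → ℝ} {q : ℕ} (hf : Function.Periodic f q) {k : ℕ}
    (hk : k ≠ 0) :
    ((q * k : ℕ) : ℝ)⁻¹ * ∑ j ∈ Finset.range (q * k), f j =
      (q : ℝ)⁻¹ * ∑ j ∈ Finset.range q, f j := by
  have h : ∀ j i, f (q * j + i) = f i := fun j i => by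
    rw [add_comm, mul_comm]; exact hf.nat_mul j i
  have hk' : (k : ℝ) ≠ 0 := Nat.cast_ne_zero.2 hk
  simp only [sum_range_mul_eq, h, Finset.sum_const, Finset.card_range, nsmul_eq_mul]
  push_cast
  rw [mul_inv, mul_assoc, inv_mul_cancel_left₀ hk']

lemma sum_range_add_of_periodic {f : ℕ → ℝ} {q : ℕ} (hf : Function.Periodic f q) (c : ℕ) :
    ∑ j ∈ Finset.range q, f (j + c) = ∑ j ∈ Finset.range q, f j := by
  induction c with
  | zero => rfl
  | succ c ih =>
    rw [← ih]
    have h1 := Finset.sum_range_succ (fun j => f (j + c)) q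
    rw [Finset.sum_range_succ' (fun j => f (j + c)) q, add_comm q c, hf c, zero_add] at h1
    simpa only [add_assoc, add_comm 1 c] using add_right_cancel h1

/-- If all but boundedly many of the blocks of length `P` of the finite sequences
`s n 0, s n 1, …` of length `N + P * k n + r n` are close to the block `L 0, …, L (P - 1)`, then
their averages converge to the average of that block. -/
lemma tendsto_average_of_blocks {ι : Type*} {l : Filter ι} {s : ι → ℕ → ℝ} {L : ℕ → ℝ} {M : ℝ}
    (hM : ∀ n j, |s n j| ≤ M) {P : ℕ} (hP : 0 < P) {N R : ℕ} {k r : ι → ℕ}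
    (hk : Tendsto k l atTop) (hr : ∀ n, r n ≤ R)
    (hclose : ∀ ε > 0, ∃ C : ℕ, ∀ᶠ n in l, ∀ j, C ≤ j → j + C ≤ k n → ∀ i < P,
      |s n (N + P * j + i) - L i| < ε) :
    Tendsto (fun n => ((N + P * k n + r n : ℕ) : ℝ)⁻¹ *
      ∑ j ∈ Finset.range (N + P * k n + r n), s n j) l
      (𝓝 ((P : ℝ)⁻¹ * ∑ i ∈ Finset.range P, L i)) := by
  rcases l.eq_or_neBot with rfl | hl
  · exact tendsto_bot
  set A := (P : ℝ)⁻¹ * ∑ i ∈ Finset.range P, L i with hA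
  have hP' : (0 : ℝ) < P := Nat.cast_pos.2 hP
  have hPA : P * A = ∑ i ∈ Finset.range P, L i := by rw [hA, mul_inv_cancel_left₀ hP'.ne']
  set B := M + (|A| + ∑ i ∈ Finset.range P, |L i|) with hB
  have hM0 : 0 ≤ M := by
    obtain ⟨n⟩ := hl.nonempty
    exact (abs_nonneg _).trans (hM n 0)
  have hS0 : 0 ≤ ∑ i ∈ Finset.range P, |L i| := Finset.sum_nonneg fun _ _ => abs_nonneg _
  have hB0 : 0 ≤ B := by positivity
  have hBA : ∀ n j, |s n j - A| ≤ B := fun n j => (abs_sub _ _).trans (by linarith [hM n j])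
  have hBL : ∀ n j, ∀ i < P, |s n j - L i| ≤ B := fun n j i hi => by
    have := Finset.single_le_sum (f := fun i => |L i|) (fun _ _ => abs_nonneg _)
      (Finset.mem_range.2 hi)
    exact (abs_sub _ _).trans (by linarith [hM n j, abs_nonneg A])
  rw [Metric.tendsto_nhds]
  intro ε hε
  obtain ⟨C, hC⟩ := hclose (ε / 2) (half_pos hε)
  set D := (N + R + 2 * C * P) * B with hD
  have hD0 : 0 ≤ D := by positivity
  obtain ⟨k₀, hk₀⟩ := exists_nat_gt (2 * D / ε)
  filter_upwards [hC, hk.eventually_ge_atTop (max k₀ 1)] with n hn hkn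
  set T := N + P * k n + r n with hT
  have hkT : k n ≤ T := by nlinarith [Nat.zero_le N, Nat.zero_le (r n)]
  have hT0 : (0 : ℝ) < T := Nat.cast_pos.2 (lt_of_lt_of_le (by omega) hkT)
  have hDT : D < T * (ε / 2) := by
    rw [div_lt_iff₀ hε] at hk₀
    have : (k₀ : ℝ) ≤ T := Nat.cast_le.2 ((le_max_left _ _).trans (hkn.trans hkT))
    nlinarith
  have hblock : ∀ j < k n, |∑ i ∈ Finset.range P, (s n (N + P * j + i) - L i)| ≤ P * (ε / 2) +
      if j ∈ Finset.range C ∪ Finset.Ico (k n - C) (k n) then P * B else 0 := by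
    intro j hjk
    refine (Finset.abs_sum_le_sum_abs _ _).trans ?_
    split_ifs with hj
    · have := Finset.sum_le_card_nsmul (Finset.range P)
        (fun i => |s n (N + P * j + i) - L i|) B fun i hi => hBL _ _ i (Finset.mem_range.1 hi)
      simp only [Finset.card_range, nsmul_eq_mul] at this
      exact this.trans (le_add_of_nonneg_left (by positivity))
    · simp only [Finset.mem_union, Finset.mem_range, Finset.mem_Ico, not_or, not_and] at hj
      have := Finset.sum_le_card_nsmul (Finset.range P)
        (fun i => |s n (N + P * j + i) - L i|) (ε / 2)
        fun i hi => (hn j (by omega) (by omega) i (Finset.mem_range.1 hi)).le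
      simpa only [Finset.card_range, nsmul_eq_mul, add_zero] using this
  have hmid : |∑ j ∈ Finset.range (k n), ∑ i ∈ Finset.range P, (s n (N + P * j + i) - L i)| ≤
      k n * (P * (ε / 2)) + 2 * C * (P * B) := by
    refine (Finset.abs_sum_le_sum_abs _ _).trans
      ((Finset.sum_le_sum fun j hj => hblock j (Finset.mem_range.1 hj)).trans ?_)
    rw [Finset.sum_add_distrib, Finset.sum_const, Finset.card_range, nsmul_eq_mul,
      ← Finset.sum_filter, Finset.sum_const, nsmul_eq_mul]
    have hcard : (Finset.filter (· ∈ Finset.range C ∪ Finset.Ico (k n - C) (k n))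
        (Finset.range (k n))).card ≤ 2 * C := by
      refine (Finset.card_le_card fun j hj => (Finset.mem_filter.1 hj).2).trans
        ((Finset.card_union_le _ _).trans ?_)
      rw [Finset.card_range, Nat.card_Ico]
      omega
    have hcard' := Nat.cast_le (α := ℝ) |>.2 hcard
    push_cast at hcard'
    gcongr
  have hsum : ∑ j ∈ Finset.range T, s n j - T * A =
      ∑ j ∈ Finset.range N, (s n j - A) +
      ∑ j ∈ Finset.range (k n), ∑ i ∈ Finset.range P, (s n (N + P * j + i) - L i) +
      ∑ j ∈ Finset.range (r n), (s n (N + P * k n + j) - A) := by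
    rw [hT, Finset.sum_range_add, Finset.sum_range_add, sum_range_mul_eq]
    simp only [Finset.sum_sub_distrib, Finset.sum_const, Finset.card_range, nsmul_eq_mul, ← hPA,
      ← add_assoc]
    push_cast
    ring
  have hcard : ∀ (m : ℕ) (g : ℕ → ℝ), (∀ j, |g j| ≤ B) → |∑ j ∈ Finset.range m, g j| ≤ m * B :=
    fun m g hg => by
      refine (Finset.abs_sum_le_sum_abs _ _).trans ?_
      have := Finset.sum_le_card_nsmul (Finset.range m) (fun j => |g j|) B fun j _ => hg j
      simpa only [Finset.card_range, nsmul_eq_mul] using this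
  have hbound : |∑ j ∈ Finset.range T, s n j - T * A| < T * ε := by
    rw [hsum]
    refine ((abs_add_le _ _).trans (add_le_add_left (abs_add_le _ _) _)).trans_lt ?_
    have h1 := hcard N (fun j => s n j - A) fun j => hBA n j
    have h2 := hcard (r n) (fun j => s n (N + P * k n + j) - A) fun j => hBA n _
    have h3 : (r n : ℝ) * B ≤ R * B := by
      have : (r n : ℝ) ≤ R := Nat.cast_le.2 (hr n)
      gcongr
    have h4 : (k n : ℝ) * P ≤ T := by
      rw [hT]; push_cast
      nlinarith [(Nat.cast_nonneg N : (0 : ℝ) ≤ N), (Nat.cast_nonneg (r n) : (0 : ℝ) ≤ r n)]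
    nlinarith [mul_le_mul_of_nonneg_right h4 (half_pos hε).le]
  rw [Real.dist_eq]
  have : (T : ℝ)⁻¹ * ∑ j ∈ Finset.range T, s n j - A =
      (T : ℝ)⁻¹ * (∑ j ∈ Finset.range T, s n j - T * A) := by
    field_simp
  rw [this, abs_mul, abs_of_pos (inv_pos.2 hT0), inv_mul_lt_iff₀ hT0]
  exact hbound

/-! ### Orbit measures -/

lemma coe_orbitMeasure (a x : ℝ) (n : ℕ) :
    (orbitMeasure a x n : Measure ℝ) =
      (n : ℝ≥0)⁻¹ • ∑ k ∈ Finset.range n, Measure.dirac ((quadMap a)^[k] x) := by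
  rw [orbitMeasure, FiniteMeasure.toMeasure_smul]
  congr 1
  exact FiniteMeasure.toMeasure_sum

lemma integral_orbitMeasure (a x : ℝ) (n : ℕ) (g : BoundedContinuousFunction ℝ ℝ) :
    ∫ y, g y ∂(orbitMeasure a x n : Measure ℝ) =
      (n : ℝ)⁻¹ * ∑ k ∈ Finset.range n, g ((quadMap a)^[k] x) := by
  rw [coe_orbitMeasure, integral_smul_nnreal_measure,
    integral_finsetSum_measure fun _ _ => g.integrable _]
  simp [NNReal.smul_def]

lemma orbitMeasure_apply (a x : ℝ) (n : ℕ) (s : Set ℝ) :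
    (orbitMeasure a x n : Measure ℝ) s =
      ((n : ℝ≥0)⁻¹ : ℝ≥0) * ∑ k ∈ Finset.range n, Measure.dirac ((quadMap a)^[k] x) s := by
  rw [coe_orbitMeasure, Measure.smul_apply, Measure.finsetSum_apply]
  rfl

lemma periodic_comp_iterate {a x : ℝ} {q : ℕ} (hq : (quadMap a)^[q] x = x) (g : ℝ → ℝ) :
    Function.Periodic (fun j => g ((quadMap a)^[j] x)) q := fun j => by
  simp only [Function.iterate_add_apply, hq]

/-- Near a periodic critical point all points have the asymptotics of the critical orbit. -/
lemma eventually_isGeneric {a : ℝ} {q : ℕ} (hq : 0 < q) (h0 : (quadMap a)^[q] 0 = 0) :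
    ∀ᶠ x in 𝓝 (0 : ℝ), IsGeneric a (orbitMeasure a 0 q) x := by
  have hS : iterSlope a q 0 0 = 0 := by
    rw [iterSlope]
    exact Finset.prod_eq_zero (Finset.mem_range.2 hq) (by simp)
  have hc : Continuous fun y : ℝ => |iterSlope a q y 0| :=
    ((continuous_iterSlope_uncurry q).comp (by fun_prop : Continuous fun y : ℝ => (a, y, (0 : ℝ)))).abs
  obtain ⟨r, hr, hball⟩ := Metric.eventually_nhds_iff.1 ((hc.tendsto 0).eventually
    (gt_mem_nhds (show |iterSlope a q 0 0| < 1 / 2 by rw [hS]; norm_num)))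
  filter_upwards [Metric.ball_mem_nhds 0 hr] with x hx
  rw [Metric.mem_ball, Real.dist_eq, sub_zero] at hx
  have hdecay : ∀ j, |(quadMap a)^[q * j] x| ≤ (1 / 2) ^ j * |x| := by
    intro j
    induction j with
    | zero => simp
    | succ j ih =>
      rw [Nat.mul_succ, add_comm, Function.iterate_add_apply]
      have h1 := iterate_sub_iterate a q ((quadMap a)^[q * j] x) 0
      rw [h0, sub_zero, sub_zero] at h1
      have hpow : (1 / 2 : ℝ) ^ j ≤ 1 := pow_le_one₀ (by norm_num) (by norm_num)
      have h2 := hball (y := (quadMap a)^[q * j] x) (by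
        rw [Real.dist_eq, sub_zero]
        nlinarith [abs_nonneg x])
      rw [h1, abs_mul, pow_succ]
      nlinarith [abs_nonneg ((quadMap a)^[q * j] x)]
  have hlim : Tendsto (fun j => (quadMap a)^[q * j] x) atTop (𝓝 0) := by
    refine squeeze_zero_norm hdecay ?_
    simpa using (tendsto_pow_atTop_nhds_zero_of_lt_one (r := (1 / 2 : ℝ)) (by norm_num)
      (by norm_num)).mul_const |x|
  rw [IsGeneric, FiniteMeasure.tendsto_iff_forall_integral_tendsto]
  intro g
  simp only [integral_orbitMeasure]
  have key := tendsto_average_of_blocks (l := atTop) (N := 0) (R := q) (k := fun n => n / q)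
    (r := fun n => n % q) (s := fun _ j => g ((quadMap a)^[j] x))
    (L := fun i => g ((quadMap a)^[i] 0)) (fun _ j => g.norm_coe_le_norm _) hq
    (Nat.tendsto_div_const_atTop hq.ne') (fun n => (Nat.mod_lt _ hq).le) ?_
  · simpa only [zero_add, Nat.div_add_mod] using key
  · intro ε hε
    have hev : ∀ᶠ j in atTop, ∀ i ∈ Finset.range q,
        |g ((quadMap a)^[i] ((quadMap a)^[q * j] x)) - g ((quadMap a)^[i] 0)| < ε := by
      refine (Filter.eventually_all_finset _).2 fun i _ => ?_
      exact Metric.tendsto_nhds.1 (((g.continuous.comp (continuous_iterate a i)).tendsto 0).comp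
        hlim) ε hε
    obtain ⟨C, hC⟩ := eventually_atTop.1 hev
    refine ⟨C, Eventually.of_forall fun n j hj _ i hi => ?_⟩
    have := hC j hj i (Finset.mem_range.2 hi)
    rwa [← Function.iterate_add_apply, add_comm i, ← zero_add (q * j)] at this

lemma isNaturalMeasure_of_periodic_critical {a : ℝ} (ha : a ∈ Set.Ioc (0 : ℝ) 2) {q : ℕ}
    (hq : 0 < q) (h0 : (quadMap a)^[q] 0 = 0) :
    IsNaturalMeasure a (orbitMeasure a 0 q) where
  isProbability := by
    constructor
    rw [orbitMeasure_apply]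
    simp only [measure_univ, Finset.sum_const, Finset.card_range, nsmul_eq_mul, mul_one]
    rw [← ENNReal.coe_natCast, ← ENNReal.coe_mul, inv_mul_cancel₀ (by positivity), ENNReal.coe_one]
  supported := by
    rw [orbitMeasure_apply, Finset.sum_eq_zero, mul_zero]
    intro k _
    rw [Measure.dirac_apply' _ measurableSet_Icc.compl, Set.indicator_of_notMem]
    exact fun h => h (iterate_mem_Icc ha (by norm_num) k)
  invariant := by
    have hm : Measurable (quadMap a) := (continuous_iterate a 1).measurable
    refine ⟨hm, Measure.ext fun s hs => ?_⟩
    rw [Measure.map_apply hm hs, orbitMeasure_apply, orbitMeasure_apply]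
    congr 1
    have h1 : ∀ k, Measure.dirac ((quadMap a)^[k] 0) (quadMap a ⁻¹' s) =
        Measure.dirac ((quadMap a)^[k + 1] 0) s := fun k => by
      rw [Function.iterate_succ_apply', Measure.dirac_apply' _ (hm hs), Measure.dirac_apply' _ hs]
      rfl
    obtain ⟨q, rfl⟩ : ∃ q', q = q' + 1 := ⟨q - 1, by omega⟩
    simp only [h1]
    rw [Finset.sum_range_succ, Finset.sum_range_succ', h0, Function.iterate_zero_apply]
  generic_pos := by
    obtain ⟨r, hr, hball⟩ := Metric.eventually_nhds_iff_ball.1 (eventually_isGeneric hq h0)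
    have hr1 : 0 < min r 1 := lt_min hr one_pos
    refine lt_of_lt_of_le ?_ (measure_mono (s := Set.Ioo 0 (min r 1)) fun x hx => ⟨?_, ?_⟩)
    · rw [Real.volume_Ioo, sub_zero]
      exact ENNReal.ofReal_pos.2 hr1
    · exact ⟨by linarith [hx.1], hx.2.le.trans (min_le_right _ _)⟩
    · refine hball x ?_
      rw [Metric.mem_ball, Real.dist_eq, sub_zero, abs_of_pos hx.1]
      exact hx.2.trans_le (min_le_left _ _)

/-! ### Convergence of the orbit measures -/

lemma integral_orbitMeasure_mul {a x : ℝ} {q : ℕ} (hq : (quadMap a)^[q] x = x) {k : ℕ}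
    (hk : k ≠ 0) (g : BoundedContinuousFunction ℝ ℝ) :
    ∫ y, g y ∂(orbitMeasure a x (q * k) : Measure ℝ) =
      ∫ y, g y ∂(orbitMeasure a x q : Measure ℝ) := by
  rw [integral_orbitMeasure, integral_orbitMeasure]
  exact average_mul_of_periodic (periodic_comp_iterate hq g) hk

lemma integral_orbitMeasure_iterate {a x : ℝ} {q : ℕ} (hq : (quadMap a)^[q] x = x) (i : ℕ)
    (g : BoundedContinuousFunction ℝ ℝ) :
    ∫ y, g y ∂(orbitMeasure a ((quadMap a)^[i] x) q : Measure ℝ) =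
      ∫ y, g y ∂(orbitMeasure a x q : Measure ℝ) := by
  rw [integral_orbitMeasure, integral_orbitMeasure,
    ← sum_range_add_of_periodic (periodic_comp_iterate hq g) i]
  simp only [Function.iterate_add_apply]

/-- Along parameters tending to `a` from the left, the averages over longer and longer initial
segments of the critical orbit that stay near the repelling orbit, up to a bounded number `m` of
final steps, converge to the average over the repelling orbit. -/
lemma LandsOnRepelling.tendsto_integral_orbitMeasure {a x : ℝ} {N P : ℕ}
    (h : LandsOnRepelling a x N P)
    (hright : ∀ᶠ t in 𝓝[<] a, (quadMap t)^[N] 0 < (quadMap t)^[N + P] 0) {δ κ : ℝ} (hδ : 0 < δ)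
    (hκ : 1 < κ) (he : ∀ᶠ t in 𝓝[<] a, ExpandsNear t x δ κ P) {t : ℕ → ℝ} {k : ℕ → ℕ} (m : ℕ)
    (ht : Tendsto t atTop (𝓝[<] a)) (hk : Tendsto k atTop atTop)
    (hstay : ∀ n, ∀ j ≤ k n, criticalReturn N P (t n) j ≤ x + δ)
    (g : BoundedContinuousFunction ℝ ℝ) :
    Tendsto (fun n => ∫ y, g y ∂(orbitMeasure (t n) 0 (N + P * k n + m) : Measure ℝ)) atTop
      (𝓝 (∫ y, g y ∂(orbitMeasure a x P : Measure ℝ))) := by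
  simp only [integral_orbitMeasure]
  refine tendsto_average_of_blocks (R := m) (r := fun _ => m)
    (s := fun n j => g ((quadMap (t n))^[j] 0)) (fun _ _ => g.norm_coe_le_norm _) h.period_pos hk
    (fun _ => le_rfl) fun ε hε => ?_
  have hcont : ∀ᶠ z in 𝓝 (a, x), ∀ i ∈ Finset.range P,
      |g ((quadMap z.1)^[i] z.2) - g ((quadMap a)^[i] x)| < ε :=
    (Filter.eventually_all_finset _).2 fun i _ =>
      Metric.tendsto_nhds.1 ((g.continuous.comp (continuous_iterate_uncurry i)).tendsto (a, x)) ε hε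
  obtain ⟨ρ, hρ, hball⟩ := Metric.eventually_nhds_iff.1 hcont
  obtain ⟨C, hC⟩ := h.exists_criticalReturn_close hright hδ hκ he hρ
  refine ⟨C, ?_⟩
  filter_upwards [ht.eventually hC,
    (ht.mono_right nhdsWithin_le_nhds).eventually (Metric.ball_mem_nhds a hρ)]
    with n hn hta j _ hj i hi
  have := hball (y := (t n, criticalReturn N P (t n) j))
    (by rw [Prod.dist_eq]; exact max_lt hta (hn (k n) (hstay n) j hj)) i (Finset.mem_range.2 hi)
  rwa [criticalReturn, ← Function.iterate_add_apply, add_comm i] at this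

theorem theoremD (a : ℝ) (ha : a ∈ Set.Ioc (0 : ℝ) 2) (p : ℕ) (x : ℝ)
    (hx : IsUnstableOrbit a x p)
    (hcrit : ∃ N : ℕ, (quadMap a)^[N] 0 ∈ orbitSet a x p) :
    ∃ (b : ℕ → ℝ) (y : ℕ → ℝ) (q : ℕ → ℕ),
      (∀ n, b n ∈ Set.Ioc (0 : ℝ) 2) ∧
      (∀ n, b n ≠ a) ∧
      Tendsto b atTop (𝓝 a) ∧
      (∀ n, IsSuperStableOrbit (b n) (y n) (q n)) ∧
      (∀ n, IsNaturalMeasure (b n) (orbitMeasure (b n) (y n) (q n))) ∧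
      Tendsto (fun n => orbitMeasure (b n) (y n) (q n)) atTop (𝓝 (orbitMeasure a x p)) := by
  obtain ⟨⟨hxI, -, hper⟩, hmult⟩ := hx
  obtain ⟨N₀, i₀, hi₀, hland⟩ := hcrit
  have hfix : (quadMap a)^[p] x = x := by
    rw [← hper]; exact Function.iterate_minimalPeriod
  -- twice the period, so that the multiplier is positive
  have h₀ : LandsOnRepelling a x (p - i₀ + N₀) (p * 2) := by
    refine ⟨ha, hxI, ?_, ?_, ?_⟩
    · rw [Function.iterate_mul]
      exact Function.iterate_fixed hfix 2
    · rw [multiplier, (hasDerivAt_iterate a p x).deriv] at hmult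
      rw [mul_two, iterSlope_add, hfix]
      rw [← abs_mul_abs_self]
      nlinarith
    · rw [Function.iterate_add_apply, ← hland, ← Function.iterate_add_apply,
        Nat.sub_add_cancel hi₀.le, hfix]
  obtain ⟨i, hright⟩ := h₀.exists_shift_eventually_lt
  have h := h₀.shift i
  obtain ⟨δ, hδ, κ, hκ, he⟩ := h.exists_expandsNear
  obtain ⟨m, hm⟩ := h.exists_periodic_critical hright hδ hκ he
  set N := p - i₀ + N₀ + i
  set P := p * 2
  have hex : ∀ n : ℕ, ∃ k, n + 1 ≤ k ∧ ∃ t ∈ Set.Ioo (max 0 (a - 1 / ((n : ℝ) + 1))) a,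
      (quadMap t)^[N + P * k + m] 0 = 0 ∧
      ∀ j ≤ k, criticalReturn N P t j ≤ (quadMap a)^[i] x + δ := fun n =>
    ((eventually_ge_atTop (n + 1)).and (hm _ (max_lt ha.1
      (sub_lt_self a (by positivity))))).exists
  choose k hkn t ht hzero hstay using hex
  have htI : ∀ n, t n ∈ Set.Ioc (0 : ℝ) 2 := fun n =>
    ⟨(le_max_left _ _).trans_lt (ht n).1, (ht n).2.le.trans ha.2⟩
  have hta : Tendsto t atTop (𝓝[<] a) := by
    refine tendsto_nhdsWithin_iff.2 ⟨?_, Eventually.of_forall fun n => (ht n).2⟩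
    refine tendsto_of_tendsto_of_tendsto_of_le_of_le (g := fun n : ℕ => a - 1 / ((n : ℝ) + 1))
      ?_ tendsto_const_nhds (fun n => ((le_max_right _ _).trans_lt (ht n).1).le)
      fun n => (ht n).2.le
    simpa using tendsto_one_div_add_atTop_nhds_zero_nat.const_sub a
  have hkt : Tendsto k atTop atTop :=
    tendsto_atTop_mono (fun n => (Nat.le_succ n).trans (hkn n)) tendsto_id
  have hTpos : ∀ n, 0 < N + P * k n + m := fun n => by
    have := Nat.mul_pos h.period_pos (lt_of_lt_of_le (Nat.succ_pos n) (hkn n))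
    omega
  have hqpos : ∀ n, 0 < Function.minimalPeriod (quadMap (t n)) 0 := fun n =>
    Function.minimalPeriod_pos_of_mem_periodicPts ⟨_, hTpos n, hzero n⟩
  have hq0 : ∀ n, (quadMap (t n))^[Function.minimalPeriod (quadMap (t n)) 0] 0 = 0 := fun n =>
    Function.iterate_minimalPeriod
  refine ⟨t, fun _ => 0, fun n => Function.minimalPeriod (quadMap (t n)) 0, htI,
    fun n => (ht n).2.ne, hta.mono_right nhdsWithin_le_nhds, fun n => ⟨⟨by norm_num, hqpos n, rfl⟩,
      ?_⟩, fun n => isNaturalMeasure_of_periodic_critical (htI n) (hqpos n) (hq0 n), ?_⟩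
  · rw [multiplier, (hasDerivAt_iterate _ _ _).deriv]
    exact Finset.prod_eq_zero (Finset.mem_range.2 (hqpos n)) (by simp)
  · rw [FiniteMeasure.tendsto_iff_forall_integral_tendsto]
    intro g
    have key := h.tendsto_integral_orbitMeasure hright hδ hκ he m hta hkt hstay g
    rw [integral_orbitMeasure_iterate h₀.iterate_eq, integral_orbitMeasure_mul hfix two_ne_zero]
      at key
    refine key.congr fun n => ?_
    -- the return time `N + P * k n + m` is a multiple of the prime period
    obtain ⟨c, hc⟩ := Function.IsPeriodicPt.minimalPeriod_dvd (hzero n)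
    have hc0 : c ≠ 0 := by
      rintro rfl
      have := hTpos n
      omega
    rw [hc, integral_orbitMeasure_mul (hq0 n) hc0]
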